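/- Let $k$ be an algebraically closed field, let $n$ be a positive integer, and let $q=(q_{ij})$ be an $n\times n$ matrix with entries in $k^\times$ such that $q_{ii}=1$ and $q_{ij}=q_{ji}^{-1}$ for all $i,j$. Assume that all $q_{ij}$ are roots of unity. Let $R=k_q[[x_1,\ldots,x_n]]$ be the $q$-commutative power series ring: its elements are the formal series $\sum_{s\in\mathbb{N}^n}c_sx^s$ with $c_s\in k$ and $x^s=x_1^{s_1}\cdots x_n^{s_n}$, and the multiplication is determined by $x_ix_j=q_{ij}x_jx_i$. Let $L=k_q[[x_1^{\pm1},\ldots,x_n^{\pm1}]]$ be the $q$-commutative Laurent series ring, the localization of $R$ at the multiplicative set generated by $x_1,\ldots,x_n$: its elements are the formal series $\sum_{s\in\mathbb{Z}^n}c_sx^s$ with $c_s=0$ for $\min\{s_1,\ldots,s_n\}\ll0$. Let $\ell$ be the order of the cyclic group generated by all the $q_{ij}$, let $\epsilon$ be a generator of this group, and let $h_{ij}$ be integers with $q_{ij}=\epsilon^{h_{ij}}$. Let $h$ be the cardinality of the image of the homomorphism $\mathbb{Z}^n\to(\mathbb{Z}/\ell\mathbb{Z})^n$ defined by the matrix $(h_{ij})$.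 A ring has PI degree $d$ if $d$ is the least positive integer $p$ such that the ring satisfies all polynomial identities (in noncommuting variables, with integer coefficients) of $p\times p$ matrices over $\mathbb{Z}$. Then $h$ is the square of an integer $d=\sqrt h$, and: (i) $R$ has PI degree $d$; (ii) $L$ is an Azumaya algebra over its center, of PI degree $d$. -/

import Mathlib

noncomputable section

/-- The scalar `∏_{j < i} q_{ij} ^ (s_i t_j)`: it is the factor that appears when the product of the
ordered monomials `x ^ s = x_1 ^ s_1 ⋯ x_n ^ s_n` and `x ^ t` is put back in order with the rules
`x_i x_j = q_{ij} x_j x_i`, that is `x ^ s * x ^ t = qFactor q s t • x ^ (s + t)`. -/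
def qFactor {k : Type*} [Field k] {n : ℕ} (q : Matrix (Fin n) (Fin n) kˣ) (s t : Fin n → ℤ) : kˣ :=
  ∏ i, ∏ j, if j < i then q i j ^ (s i * t j) else 1

/-- The families `(c_s)` of scalars, indexed by `s ∈ ℤ ^ n`, with `c_s = 0` for
`min {s_1, …, s_n} ≪ 0`. -/
def laurentFamilies (k : Type*) [Field k] (n : ℕ) : Submodule k ((Fin n → ℤ) → k) where
  carrier := {f | ∃ N : ℤ, ∀ s, f s ≠ 0 → ∀ i, N ≤ s i}
  zero_mem' := ⟨0, fun s hs => absurd rfl hs⟩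
  add_mem' := by
    rintro f g ⟨N, hN⟩ ⟨M, hM⟩
    refine ⟨min N M, fun s hs i => ?_⟩
    by_cases hf : f s = 0
    · have hg : g s ≠ 0 := fun hg => hs (by simp [hf, hg])
      exact (min_le_right _ _).trans (hM s hg i)
    · exact (min_le_left _ _).trans (hN s hf i)
  smul_mem' := by
    rintro c f ⟨N, hN⟩
    exact ⟨N, fun s hs i => hN s (fun h => hs (by simp [h])) i⟩

/-- The `q`-commutative Laurent series ring `L = k_q[[x_1 ^ {±1}, …, x_n ^ {±1}]]`: its elements are
the formal series `∑ c_s x ^ s` over `s ∈ ℤ ^ n` with `c_s = 0` for `min {s_1, …, s_n} ≪ 0`. -/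
def QLaurent {k : Type*} [Field k] {n : ℕ} (_q : Matrix (Fin n) (Fin n) kˣ) : Type _ :=
  laurentFamilies k n

namespace QLaurent

variable {k : Type*} [Field k] {n : ℕ} {q : Matrix (Fin n) (Fin n) kˣ}

instance : AddCommGroup (QLaurent q) := inferInstanceAs (AddCommGroup (laurentFamilies k n))

instance : Module k (QLaurent q) := inferInstanceAs (Module k (laurentFamilies k n))

/-- The coefficient `c_s` of a Laurent series. -/
def coeff (f : QLaurent q) (s : Fin n → ℤ) : k := (show laurentFamilies k n from f).1 s

theorem exists_bound (f : QLaurent q) : ∃ N : ℤ, ∀ s, f.coeff s ≠ 0 → ∀ i, N ≤ s i :=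
  (show laurentFamilies k n from f).2

@[ext]
theorem ext {f g : QLaurent q} (h : ∀ s, f.coeff s = g.coeff s) : f = g :=
  Subtype.ext (funext h)

/-- A Laurent series from its family of coefficients. -/
def mk (c : (Fin n → ℤ) → k) (h : ∃ N : ℤ, ∀ s, c s ≠ 0 → ∀ i, N ≤ s i) : QLaurent q :=
  (⟨c, h⟩ : laurentFamilies k n)

@[simp] theorem coeff_mk (c : (Fin n → ℤ) → k) (h) (s : Fin n → ℤ) :
    (mk c h : QLaurent q).coeff s = c s := rfl

@[simp] theorem coeff_zero (s : Fin n → ℤ) : (0 : QLaurent q).coeff s = 0 := rfl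

@[simp] theorem coeff_add (f g : QLaurent q) (s : Fin n → ℤ) :
    (f + g).coeff s = f.coeff s + g.coeff s := rfl

@[simp] theorem coeff_smul (a : k) (f : QLaurent q) (s : Fin n → ℤ) :
    (a • f).coeff s = a * f.coeff s := rfl

/-- One term of the coefficient of `x ^ s` in a product: the contribution of the exponents
`a` and `s - a`. -/
def mulTerm (f g : QLaurent q) (s a : Fin n → ℤ) : k :=
  f.coeff a * g.coeff (s - a) * (qFactor q a (s - a) : k)

theorem mulTerm_support {f g : QLaurent q} {N M : ℤ}
    (hN : ∀ s, f.coeff s ≠ 0 → ∀ i, N ≤ s i) (hM : ∀ s, g.coeff s ≠ 0 → ∀ i, M ≤ s i)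
    (s : Fin n → ℤ) :
    Function.support (mulTerm f g s) ⊆
      (Finset.Icc (fun _ => N) (fun i => s i - M) : Finset (Fin n → ℤ)) := by
  intro a ha
  have h1 : f.coeff a ≠ 0 := fun h => ha (by simp [mulTerm, h])
  have h2 : g.coeff (s - a) ≠ 0 := fun h => ha (by simp [mulTerm, h])
  simp only [Finset.coe_Icc, Set.mem_Icc, Pi.le_def]
  refine ⟨hN a h1, fun i => ?_⟩
  have := hM _ h2 i
  simp only [Pi.sub_apply] at this
  linarith

theorem mulTerm_finite (f g : QLaurent q) (s : Fin n → ℤ) :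
    (Function.support (mulTerm f g s)).Finite := by
  obtain ⟨N, hN⟩ := f.exists_bound
  obtain ⟨M, hM⟩ := g.exists_bound
  exact (Finset.finite_toSet _).subset (mulTerm_support hN hM s)

/-- The product `(∑ f_a x ^ a) (∑ g_b x ^ b) = ∑ f_a g_b x ^ a x ^ b`; the sum over `a + b = s` that
gives the coefficient of `x ^ s` has only finitely many nonzero terms (`mulTerm_finite`). -/
instance : Mul (QLaurent q) where
  mul f g := mk (fun s => ∑ᶠ a, mulTerm f g s a) <| by
    obtain ⟨N, hN⟩ := f.exists_bound
    obtain ⟨M, hM⟩ := g.exists_bound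
    refine ⟨N + M, fun s hs i => ?_⟩
    obtain ⟨a, ha⟩ : ∃ a, mulTerm f g s a ≠ 0 := by
      by_contra! h
      exact hs (by simp [h])
    have := mulTerm_support hN hM s ha
    simp only [Finset.coe_Icc, Set.mem_Icc, Pi.le_def] at this
    have h1 := this.1 i
    have h2 := this.2 i
    linarith

theorem coeff_mul (f g : QLaurent q) (s : Fin n → ℤ) :
    (f * g).coeff s = ∑ᶠ a, mulTerm f g s a := rfl

/-- The series `c x ^ s` with a single term. -/
def monomial (s : Fin n → ℤ) (c : k) : QLaurent q :=
  mk (Pi.single s c) <| by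
    refine ⟨-∑ i, |s i|, fun t ht i => ?_⟩
    have : t = s := by
      by_contra h
      exact ht (by simp [h])
    subst this
    have h1 : |t i| ≤ ∑ i, |t i| :=
      Finset.single_le_sum (f := fun i => |t i|) (fun j _ => abs_nonneg _) (Finset.mem_univ i)
    have h2 := neg_abs_le (t i)
    linarith

theorem coeff_monomial (s t : Fin n → ℤ) (c : k) :
    (monomial s c : QLaurent q).coeff t = if t = s then c else 0 := by
  simp [monomial, Pi.single_apply]

instance : One (QLaurent q) := ⟨monomial 0 1⟩

/-- The indeterminate `x_i`. -/
def X (i : Fin n) : QLaurent q := monomial (Pi.single i 1) 1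

theorem one_def : (1 : QLaurent q) = monomial 0 1 := rfl

theorem qFactor_add_left (s s' t : Fin n → ℤ) :
    qFactor q (s + s') t = qFactor q s t * qFactor q s' t := by
  simp only [qFactor, ← Finset.prod_mul_distrib]
  refine Finset.prod_congr rfl fun i _ => Finset.prod_congr rfl fun j _ => ?_
  split_ifs <;> simp [add_mul, zpow_add]

theorem qFactor_add_right (s t t' : Fin n → ℤ) :
    qFactor q s (t + t') = qFactor q s t * qFactor q s t' := by
  simp only [qFactor, ← Finset.prod_mul_distrib]
  refine Finset.prod_congr rfl fun i _ => Finset.prod_congr rfl fun j _ => ?_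
  split_ifs <;> simp [mul_add, zpow_add]

@[simp] theorem qFactor_zero_left (t : Fin n → ℤ) : qFactor q 0 t = 1 := by simp [qFactor]

@[simp] theorem qFactor_zero_right (s : Fin n → ℤ) : qFactor q s 0 = 1 := by simp [qFactor]

theorem coeff_monomial_mul (s : Fin n → ℤ) (c : k) (g : QLaurent q) (t : Fin n → ℤ) :
    (monomial s c * g).coeff t = c * g.coeff (t - s) * (qFactor q s (t - s) : k) := by
  rw [coeff_mul, finsum_eq_single _ s]
  · simp [mulTerm, coeff_monomial]
  · intro a ha
    simp [mulTerm, coeff_monomial, ha]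

theorem coeff_mul_monomial (f : QLaurent q) (s : Fin n → ℤ) (c : k) (t : Fin n → ℤ) :
    (f * monomial s c).coeff t = f.coeff (t - s) * c * (qFactor q (t - s) s : k) := by
  rw [coeff_mul, finsum_eq_single _ (t - s)]
  · simp [mulTerm, coeff_monomial]
  · intro a ha
    have : t - a ≠ s := fun h => ha (by rw [← h]; abel)
    simp [mulTerm, coeff_monomial, this]

theorem monomial_mul_monomial (s t : Fin n → ℤ) (a b : k) :
    (monomial s a * monomial t b : QLaurent q) =
      monomial (s + t) (a * b * (qFactor q s t : k)) := by
  ext u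
  rw [coeff_monomial_mul, coeff_monomial, coeff_monomial]
  by_cases h : u = s + t
  · subst h; simp
  · have : u - s ≠ t := fun h' => h (by rw [← h']; abel)
    simp [h, this]

theorem mul_assoc' (f g h : QLaurent q) : f * g * h = f * (g * h) := by
  obtain ⟨N, hN⟩ := f.exists_bound
  obtain ⟨M, hM⟩ := g.exists_bound
  obtain ⟨P, hP⟩ := h.exists_bound
  ext s
  let F : (Fin n → ℤ) → (Fin n → ℤ) → k := fun a u =>
    f.coeff a * g.coeff (u - a) * h.coeff (s - u) *
      ((qFactor q a (u - a) : k) * qFactor q a (s - u) * qFactor q (u - a) (s - u))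
  have hFne : ∀ a u, F a u ≠ 0 → f.coeff a ≠ 0 ∧ g.coeff (u - a) ≠ 0 ∧ h.coeff (s - u) ≠ 0 := by
    intro a u hF
    refine ⟨fun h0 => hF ?_, fun h0 => hF ?_, fun h0 => hF ?_⟩ <;> simp [F, h0]
  let A : Finset (Fin n → ℤ) := Finset.Icc (fun _ => N) (fun i => s i - P - M)
  let B : Finset (Fin n → ℤ) := Finset.Icc (fun _ => N + M) (fun i => s i - P)
  have hA : ∀ a u, F a u ≠ 0 → a ∈ A := by
    intro a u hF
    obtain ⟨h1, h2, h3⟩ := hFne a u hF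
    simp only [A, Finset.mem_Icc, Pi.le_def]
    refine ⟨hN _ h1, fun i => ?_⟩
    have h2 := hM _ h2 i
    have h3 := hP _ h3 i
    simp only [Pi.sub_apply] at h2 h3
    linarith
  have hB : ∀ a u, F a u ≠ 0 → u ∈ B := by
    intro a u hF
    obtain ⟨h1, h2, h3⟩ := hFne a u hF
    simp only [B, Finset.mem_Icc, Pi.le_def]
    refine ⟨fun i => ?_, fun i => ?_⟩
    · have h1 := hN _ h1 i
      have h2 := hM _ h2 i
      simp only [Pi.sub_apply] at h2
      linarith
    · have h3 := hP _ h3 i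
      simp only [Pi.sub_apply] at h3
      linarith
  have hl : ∀ u, mulTerm (f * g) h s u = ∑ a ∈ A, F a u := by
    intro u
    rw [← finsum_eq_sum_of_support_subset (fun a => F a u) (fun a ha => hA a u ha), mulTerm,
      coeff_mul, mul_assoc, finsum_mul' _ _ (mulTerm_finite f g u)]
    refine finsum_congr fun a => ?_
    have : qFactor q u (s - u) = qFactor q a (s - u) * qFactor q (u - a) (s - u) := by
      rw [← qFactor_add_left, add_sub_cancel]
    simp only [mulTerm, F, this, Units.val_mul]
    ring
  have hr : ∀ a, mulTerm f (g * h) s a = ∑ u ∈ B, F a u := by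
    intro a
    rw [← finsum_eq_sum_of_support_subset (fun u => F a u) (fun u hu => hB a u hu), mulTerm,
      coeff_mul, mul_assoc, mul_comm, mul_assoc, finsum_mul' _ _ (mulTerm_finite g h _),
      ← finsum_comp_equiv (Equiv.subRight a)]
    refine finsum_congr fun u => ?_
    have e : s - a - (u - a) = s - u := by abel
    have : qFactor q a (s - a) = qFactor q a (u - a) * qFactor q a (s - u) := by
      rw [← qFactor_add_right]; congr 1; abel
    simp only [mulTerm, F, this, Units.val_mul, Equiv.subRight_apply, e]
    ring
  rw [coeff_mul, coeff_mul, finsum_congr hl, finsum_congr hr,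
    finsum_eq_sum_of_support_subset (s := B), finsum_eq_sum_of_support_subset (s := A)]
  · exact Finset.sum_comm
  · intro a ha
    obtain ⟨u, _, hu⟩ := Finset.exists_ne_zero_of_sum_ne_zero ha
    exact hA a u hu
  · intro u hu
    obtain ⟨a, _, ha⟩ := Finset.exists_ne_zero_of_sum_ne_zero hu
    exact hB a u ha

instance : Ring (QLaurent q) :=
  { (inferInstance : AddCommGroup (QLaurent q)) with
    mul := (· * ·)
    one := 1
    left_distrib := by
      intro f g h
      ext s
      rw [coeff_add, coeff_mul, coeff_mul, coeff_mul,
        ← finsum_add_distrib (mulTerm_finite f g s) (mulTerm_finite f h s)]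
      refine finsum_congr fun a => ?_
      simp only [mulTerm, coeff_add]
      ring
    right_distrib := by
      intro f g h
      ext s
      rw [coeff_add, coeff_mul, coeff_mul, coeff_mul,
        ← finsum_add_distrib (mulTerm_finite f h s) (mulTerm_finite g h s)]
      refine finsum_congr fun a => ?_
      simp only [mulTerm, coeff_add]
      ring
    zero_mul := by
      intro f
      ext s
      rw [coeff_mul]
      simp [mulTerm]
    mul_zero := by
      intro f
      ext s
      rw [coeff_mul]
      simp [mulTerm]
    mul_assoc := mul_assoc'
    one_mul := by
      intro f
      ext s
      rw [one_def, coeff_monomial_mul]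
      simp
    mul_one := by
      intro f
      ext s
      rw [one_def, coeff_mul_monomial]
      simp }

instance : Algebra k (QLaurent q) :=
  Algebra.ofModule
    (by
      intro a f g
      ext s
      rw [coeff_smul, coeff_mul, coeff_mul, mul_finsum' _ _ (mulTerm_finite f g s)]
      refine finsum_congr fun b => ?_
      simp only [mulTerm, coeff_smul]
      ring)
    (by
      intro a f g
      ext s
      rw [coeff_smul, coeff_mul, coeff_mul, mul_finsum' _ _ (mulTerm_finite f g s)]
      refine finsum_congr fun b => ?_
      simp only [mulTerm, coeff_smul]
      ring)

/-- The defining relations `x_i x_j = q_{ij} x_j x_i`. -/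
theorem X_mul_X (hq1 : ∀ i, q i i = 1) (hq : ∀ i j, q i j = (q j i)⁻¹) (i j : Fin n) :
    (X i * X j : QLaurent q) = (q i j : k) • (X j * X i) := by
  have key : ∀ i j : Fin n, qFactor q (Pi.single i 1) (Pi.single j 1) =
      if j < i then q i j else 1 := by
    intro i j
    rw [qFactor, Finset.prod_eq_single i, Finset.prod_eq_single j]
    · simp
    · intro b _ hb
      simp [hb]
    · simp
    · intro b _ hb
      simp [hb]
    · simp
  ext u
  rw [coeff_smul, X, X, monomial_mul_monomial, monomial_mul_monomial, coeff_monomial,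
    coeff_monomial, key, key, add_comm (Pi.single j 1)]
  rcases lt_trichotomy i j with h | h | h
  · simp only [h, not_lt_of_gt h, if_true, if_false]
    rw [hq i j]
    split_ifs <;> simp
  · subst h
    simp [hq1]
  · simp only [h, not_lt_of_gt h, if_true, if_false]
    split_ifs <;> simp

end QLaurent

/-- The `q`-commutative power series ring `R = k_q[[x_1, …, x_n]]`, realized inside `L`: its elements
are the formal series `∑ c_s x ^ s` over `s ∈ ℕ ^ n`. -/
def qPowerSeries {k : Type*} [Field k] {n : ℕ} (q : Matrix (Fin n) (Fin n) kˣ) :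
    Subalgebra k (QLaurent q) where
  carrier := {f | ∀ s, f.coeff s ≠ 0 → ∀ i, 0 ≤ s i}
  add_mem' := by
    intro f g hf hg s hs i
    by_cases h : f.coeff s = 0
    · exact hg s (fun h' => hs (by simp [h, h'])) i
    · exact hf s h i
  mul_mem' := by
    intro f g hf hg s hs i
    obtain ⟨a, ha⟩ : ∃ a, QLaurent.mulTerm f g s a ≠ 0 := by
      by_contra! h
      exact hs (by rw [QLaurent.coeff_mul]; simp [h])
    have := QLaurent.mulTerm_support hf hg s ha
    simp only [Finset.coe_Icc, Set.mem_Icc, Pi.le_def] at this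
    have h1 := this.1 i
    have h2 := this.2 i
    linarith
  algebraMap_mem' := by
    intro c s hs i
    rw [Algebra.algebraMap_eq_smul_one, QLaurent.coeff_smul, QLaurent.one_def,
      QLaurent.coeff_monomial] at hs
    by_cases h : s = 0
    · simp [h]
    · simp [h] at hs

namespace QLaurent

variable {k : Type*} [Field k] {n : ℕ} {q : Matrix (Fin n) (Fin n) kˣ}

theorem isUnit_monomial (s : Fin n → ℤ) {c : k} (hc : c ≠ 0) :
    IsUnit (monomial s c : QLaurent q) := by
  have hF : (qFactor q s (-s) : k) ≠ 0 := Units.ne_zero _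
  have hG : (qFactor q (-s) s : k) ≠ 0 := Units.ne_zero _
  rw [isUnit_iff_exists_and_exists]
  refine ⟨⟨monomial (-s) (c⁻¹ * (qFactor q s (-s) : k)⁻¹), ?_⟩,
    ⟨monomial (-s) (c⁻¹ * (qFactor q (-s) s : k)⁻¹), ?_⟩⟩
  · rw [monomial_mul_monomial, one_def, add_neg_cancel]
    congr 1
    field_simp
  · rw [monomial_mul_monomial, one_def, neg_add_cancel]
    congr 1
    field_simp

theorem X_mem_qPowerSeries (i : Fin n) : (X i : QLaurent q) ∈ qPowerSeries q := by
  intro s hs j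
  rw [X, coeff_monomial] at hs
  have : s = Pi.single i 1 := by
    by_contra h
    simp [h] at hs
  subst this
  by_cases h : j = i
  · subst h; simp
  · simp [h]

/-- `L` is the left ring of fractions of `R` at the multiplicative set generated by the `x_i`: the
`x_i` are invertible in `L` (`isUnit_X`), and every element of `L` is a fraction `u⁻¹ r` with `r ∈ R`
and `u` a product of indeterminates. -/
theorem exists_mul_mem_qPowerSeries (f : QLaurent q) :
    ∃ u ∈ Submonoid.closure (Set.range (X : Fin n → QLaurent q)), u * f ∈ qPowerSeries q := by
  obtain ⟨N, hN⟩ := f.exists_bound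
  have hpow : ∀ (i : Fin n) (m : ℕ), ∃ c : k,
      (X i : QLaurent q) ^ m = monomial (Pi.single i (m : ℤ)) c := by
    intro i m
    induction m with
    | zero => exact ⟨1, by simp [one_def]⟩
    | succ m ih =>
      obtain ⟨c, hc⟩ := ih
      refine ⟨c * 1 * (qFactor q (Pi.single i (m : ℤ)) (Pi.single i 1) : k), ?_⟩
      rw [pow_succ, hc, X, monomial_mul_monomial, ← Pi.single_add, Nat.cast_succ]
  have key : ∀ T : Finset (Fin n), ∃ u ∈ Submonoid.closure (Set.range (X : Fin n → QLaurent q)),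
      ∃ c : k, u = monomial (fun i => if i ∈ T then (N.natAbs : ℤ) else 0) c := by
    intro T
    induction T using Finset.induction_on with
    | empty => exact ⟨1, one_mem _, 1, by rw [one_def]; rfl⟩
    | insert a T ha ih =>
      obtain ⟨u, hu, c, hc⟩ := ih
      obtain ⟨b, hb⟩ := hpow a N.natAbs
      refine ⟨X a ^ N.natAbs * u,
        mul_mem (pow_mem (Submonoid.subset_closure (Set.mem_range_self a)) _) hu, ?_⟩
      refine ⟨b * c * (qFactor q (Pi.single a (N.natAbs : ℤ))
          (fun i => if i ∈ T then (N.natAbs : ℤ) else 0) : k), ?_⟩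
      rw [hb, hc, monomial_mul_monomial]
      congr 1
      funext i
      by_cases hi : i = a
      · subst hi; simp [ha]
      · simp [hi]
  obtain ⟨u, hu, c, hc⟩ := key Finset.univ
  refine ⟨u, hu, fun s hs i => ?_⟩
  rw [hc, coeff_monomial_mul] at hs
  have hf : f.coeff (s - fun i => if i ∈ Finset.univ then (N.natAbs : ℤ) else 0) ≠ 0 :=
    fun h => hs (by rw [h]; simp)
  have := hN _ hf i
  simp only [Finset.mem_univ, if_true, Pi.sub_apply] at this
  omega

theorem isUnit_X (i : Fin n) : IsUnit (X i : QLaurent q) := isUnit_monomial _ one_ne_zero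

end QLaurent

/-- The noncommutative integer polynomial `f` is a polynomial identity of the ring `A`: it vanishes
under all substitutions of elements of `A` for its variables. -/
def IsPolynomialIdentity (f : FreeAlgebra ℤ ℕ) (A : Type*) [Ring A] : Prop :=
  ∀ a : ℕ → A, FreeAlgebra.lift ℤ a f = 0

/-- The ring `A` has PI degree `d`: `d` is the least positive integer `p` such that `A` satisfies all
polynomial identities of `p × p` matrices over `ℤ`. -/
def HasPIDegree (A : Type*) [Ring A] (d : ℕ) : Prop :=
  IsLeast {p : ℕ | 0 < p ∧ ∀ f : FreeAlgebra ℤ ℕ,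
    IsPolynomialIdentity f (Matrix (Fin p) (Fin p) ℤ) → IsPolynomialIdentity f A} d

/-- The homomorphism `H : ℤ ^ n → (ℤ / ℓ) ^ n` given by an integer matrix. -/
def exponentHom {n : ℕ} (η : Matrix (Fin n) (Fin n) ℤ) (l : ℕ) :
    (Fin n → ℤ) →+ (Fin n → ZMod l) where
  toFun s i := ((η.mulVec s i : ℤ) : ZMod l)
  map_zero' := by funext i; simp
  map_add' s t := by funext i; simp [Matrix.mulVec_add]

end

noncomputable section


/-! Monomials commute up to scalars, `x ^ s x ^ t = b(s, t) x ^ t x ^ s`, where `b` is the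
alternating pairing `commutation`. Its radical `S` is the kernel of `exponentHom`
(`ker_exponentHom`), so `S` has index `h`. A maximal isotropic subgroup `M` is its own annihilator,
and duality gives `[ℤ ^ n : M] = [M : S]` (`index_sq_eq_index_ker`); hence `h = d ^ 2` with `d = [ℤ
^ n : M]`.

Upper bound: the series supported in `M` form a commutative ring over which `L` is free of rank `d`
on the right, and left multiplication embeds `L` into `d × d` matrices over it
(`isPolynomialIdentity_of_commutation_eq_zero`). The bound passes to `R ⊆ L`.

Lower bound: averaging over conjugations by the monomials with exponents in `[0, l) ^ n` isolates
one class modulo `S`, by orthogonality of characters. So a Capelli polynomial in `h` variables takes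
a nonzero value, even on `R`, whereas it vanishes on `p × p` matrices when `p ^ 2 < h`
(`index_ker_commutation_le`).

Azumaya: the center consists of the series supported in `S`, and `L` is free of rank `h` over it.
The same averages make `L ⊗ Lᵒᵖ → End L` surjective, and equality of ranks makes it bijective. -/

theorem RingHom.map_freeAlgebra_lift {A B : Type*} [Ring A] [Ring B] (φ : A →+* B) (a : ℕ → A)
    (f : FreeAlgebra ℤ ℕ) :
    φ (FreeAlgebra.lift ℤ a f) = FreeAlgebra.lift ℤ (φ ∘ a) f := by
  have : φ.toIntAlgHom.comp (FreeAlgebra.lift ℤ a) = FreeAlgebra.lift ℤ (φ ∘ a) := by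
    ext i
    simp
  exact DFunLike.congr_fun this f

/-! ### Transfer of polynomial identities between rings -/

namespace IsPolynomialIdentity

variable {f : FreeAlgebra ℤ ℕ}

theorem of_injective {A B : Type*} [Ring A] [Ring B] (hf : IsPolynomialIdentity f B) (φ : A →+* B)
    (hφ : Function.Injective φ) : IsPolynomialIdentity f A := fun a =>
  hφ (by rw [φ.map_freeAlgebra_lift, hf, map_zero])

theorem of_surjective {A B : Type*} [Ring A] [Ring B] (hf : IsPolynomialIdentity f A) (φ : A →+* B)
    (hφ : Function.Surjective φ) : IsPolynomialIdentity f B := fun b => by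
  obtain ⟨a, rfl⟩ := hφ.comp_left b
  rw [← φ.map_freeAlgebra_lift, hf, map_zero]

/-- A polynomial over `ℤ` is determined by its values at integer points, so each matrix entry can be
tested after specialization to `ℤ`. -/
theorem matrix_mvPolynomial {p : ℕ} (hf : IsPolynomialIdentity f (Matrix (Fin p) (Fin p) ℤ))
    (σ : Type*) : IsPolynomialIdentity f (Matrix (Fin p) (Fin p) (MvPolynomial σ ℤ)) := by
  intro g
  ext1 i j
  refine MvPolynomial.funext fun x => ?_
  have h := hf ((MvPolynomial.eval x).mapMatrix ∘ g)
  rw [← RingHom.map_freeAlgebra_lift] at h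
  simpa using congrFun (congrFun h i) j

/-- Polynomial identities of integer matrices hold for matrices over every commutative ring. -/
theorem matrix {p : ℕ} (hf : IsPolynomialIdentity f (Matrix (Fin p) (Fin p) ℤ))
    (C : Type*) [CommRing C] : IsPolynomialIdentity f (Matrix (Fin p) (Fin p) C) := by
  -- One variable for each element of `C` makes `C` a quotient of an integer polynomial ring.
  let φ : MvPolynomial C ℤ →+* C := MvPolynomial.eval₂Hom (Int.castRingHom C) id
  have hφ : Function.Surjective φ := fun c => ⟨MvPolynomial.X c, by simp [φ]⟩
  refine (hf.matrix_mvPolynomial C).of_surjective φ.mapMatrix fun a => ?_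
  choose g hg using fun i j => hφ (a i j)
  exact ⟨Matrix.of g, by ext i j; exact hg i j⟩

/-- A ring acting faithfully on a free module of rank `p` over a commutative ring satisfies the
polynomial identities of `p × p` matrices. -/
theorem of_faithful_action {p : ℕ} (hf : IsPolynomialIdentity f (Matrix (Fin p) (Fin p) ℤ))
    {A C N ι : Type*} [Ring A] [CommRing C] [AddCommGroup N] [Module C N] [Finite ι]
    (b : Module.Basis ι C N) (hp : Nat.card ι = p) (φ : A →+* Module.End C N)
    (hφ : Function.Injective φ) : IsPolynomialIdentity f A := by
  have e : ι ≃ Fin p := Finite.equivFinOfCardEq hp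
  exact (hf.matrix C).of_injective
    (((LinearMap.toMatrixAlgEquiv (b.reindex e)) : Module.End C N →+* _).comp φ)
    ((LinearMap.toMatrixAlgEquiv (b.reindex e)).injective.comp hφ)

end IsPolynomialIdentity

/-! ### Capelli polynomials -/

/-- The alternating sum `∑_σ sgn(σ) ∏_i a_i y_{σ(i)} b_i`. -/
def capelli {A : Type*} [Ring A] {m : ℕ} (y a b : Fin m → A) : A :=
  ∑ σ : Equiv.Perm (Fin m), (Equiv.Perm.sign σ : ℤ) •
    (List.ofFn fun i => a i * y (σ i) * b i).prod

theorem map_capelli {A B : Type*} [Ring A] [Ring B] (φ : A →+* B) {m : ℕ} (y a b : Fin m → A) :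
    φ (capelli y a b) = capelli (φ ∘ y) (φ ∘ a) (φ ∘ b) := by
  simp only [capelli, map_sum, map_zsmul, map_list_prod, List.map_ofFn]
  simp [Function.comp_def]

/-- The polynomial whose substitution instances are the expressions `capelli y a b`. -/
def capelliPolynomial (m : ℕ) : FreeAlgebra ℤ ℕ :=
  capelli (m := m) (fun i => FreeAlgebra.ι ℤ (3 * i)) (fun i => FreeAlgebra.ι ℤ (3 * i + 1))
    (fun i => FreeAlgebra.ι ℤ (3 * i + 2))

theorem lift_capelliPolynomial {A : Type*} [Ring A] (m : ℕ) (v : ℕ → A) :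
    FreeAlgebra.lift ℤ v (capelliPolynomial m) =
      capelli (m := m) (fun i => v (3 * i)) (fun i => v (3 * i + 1)) (fun i => v (3 * i + 2)) := by
  have := map_capelli (FreeAlgebra.lift ℤ v).toRingHom (m := m) (fun i => FreeAlgebra.ι ℤ (3 * i))
    (fun i => FreeAlgebra.ι ℤ (3 * i + 1)) (fun i => FreeAlgebra.ι ℤ (3 * i + 2))
  exact this.trans (by simp [Function.comp_def])

theorem capelli_eq_zero_of_isPolynomialIdentity {A : Type*} [Ring A] {m : ℕ}
    (h : IsPolynomialIdentity (capelliPolynomial m) A) (y a b : Fin m → A) :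
    capelli y a b = 0 := by
  let w : Fin 3 → Fin m → A := ![y, a, b]
  -- The three families are interleaved: the residue modulo 3 selects the family and the quotient
  -- the index. The value `0` is never read.
  let v : ℕ → A := fun r => if hr : r / 3 < m then w (Fin.ofNat 3 r) ⟨r / 3, hr⟩ else 0
  have hv : ∀ (c : Fin 3) (i : Fin m), v (3 * i + c) = w c i := by
    intro c i
    have h1 : (3 * (i : ℕ) + c) / 3 = i := by omega
    have h2 : Fin.ofNat 3 (3 * (i : ℕ) + c) = c := by
      ext
      simp [Fin.ofNat]
    simp only [v, h1, h2, i.2, dite_true]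
  have := h v
  rw [lift_capelliPolynomial] at this
  have h0 : (fun i : Fin m => v (3 * i)) = y := funext fun i => hv 0 i
  have h1 : (fun i : Fin m => v (3 * i + 1)) = a := funext fun i => hv 1 i
  have h2 : (fun i : Fin m => v (3 * i + 2)) = b := funext fun i => hv 2 i
  rwa [h0, h1, h2] at this

/-- `capelli` vanishes on matrices if there are more variables than matrix entries. -/
theorem isPolynomialIdentity_capelliPolynomial {p m : ℕ} (h : p ^ 2 < m) :
    IsPolynomialIdentity (capelliPolynomial m) (Matrix (Fin p) (Fin p) ℤ) := by
  intro v
  rw [lift_capelliPolynomial]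
  generalize (fun i : Fin m => v (3 * i)) = y
  generalize (fun i : Fin m => v (3 * i + 1)) = a
  generalize (fun i : Fin m => v (3 * i + 2)) = b
  let μ : MultilinearMap ℤ (fun _ : Fin m => Matrix (Fin p) (Fin p) ℤ) (Matrix (Fin p) (Fin p) ℤ) :=
    (MultilinearMap.mkPiAlgebraFin ℤ m (Matrix (Fin p) (Fin p) ℤ)).compLinearMap
      fun i => LinearMap.mulLeftRight ℤ (a i, b i)
  have hμ : MultilinearMap.alternatization μ y = capelli y a b := by
    rw [MultilinearMap.alternatization_apply]
    rfl
  rw [← hμ]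
  -- More than `p ^ 2` matrices are linearly dependent over `ℤ`, and an alternating map vanishes on
  -- them.
  refine AlternatingMap.map_linearDependent _ _ fun hy => ?_
  have := hy.fintype_card_le_finrank
  rw [Module.finrank_matrix] at this
  simp at this
  nlinarith

/-- If the variables of `capelli` can be separated by sums of two-sided multiplications, then some
value of `capelli` is nonzero. -/
theorem exists_capelli_ne_zero {A : Type*} [Ring A] [Nontrivial A] {m : ℕ} {T : Type*} [Fintype T]
    (y : Fin m → A) (a b : Fin m → T → A)
    (hne : ∀ i j, i ≠ j → ∑ t, a i t * y j * b i t = 0)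
    (hunit : ∀ i, IsUnit (∑ t, a i t * y i * b i t)) :
    ∃ r : Fin m → T, capelli y (fun i => a i (r i)) (fun i => b i (r i)) ≠ 0 := by
  by_contra! h
  -- By multilinearity, summing over all `r` puts the separating sum into each factor. A permutation
  -- `σ ≠ 1` moves some `i` and so contributes a zero factor; only `σ = 1` survives.
  have hsum : ∑ r : Fin m → T, capelli y (fun i => a i (r i)) (fun i => b i (r i)) =
      (List.ofFn fun i => ∑ t, a i t * y i * b i t).prod := by
    simp only [capelli]
    rw [Finset.sum_comm]
    have key : ∀ σ : Equiv.Perm (Fin m),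
        ∑ r : Fin m → T, (List.ofFn fun i => a i (r i) * y (σ i) * b i (r i)).prod =
          (List.ofFn fun i => ∑ t, a i t * y (σ i) * b i t).prod := fun σ =>
      ((MultilinearMap.mkPiAlgebraFin ℤ m A).map_sum fun i t => a i t * y (σ i) * b i t).symm
    simp only [← Finset.smul_sum, key]
    rw [Finset.sum_eq_single 1]
    · simp
    · intro σ _ hσ
      obtain ⟨i, hi⟩ : ∃ i, σ i ≠ i := by
        by_contra! h'
        exact hσ (Equiv.ext h')
      rw [List.prod_eq_zero, smul_zero]
      exact (List.mem_ofFn).2 ⟨i, hne i _ hi.symm⟩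
    · simp
  rw [Finset.sum_eq_zero fun r _ => h r] at hsum
  have hu : IsUnit (List.ofFn fun i => ∑ t, a i t * y i * b i t).prod := by
    refine List.prod_isUnit fun x hx => ?_
    obtain ⟨i, rfl⟩ := (List.mem_ofFn).1 hx
    exact hunit i
  rw [← hsum] at hu
  exact not_isUnit_zero hu


/-! ### Pairings of abelian groups and self-annihilating subgroups -/

/-- Two groups in nondegenerate duality with values in the units of a field have the same order. -/
theorem card_le_of_injective_pairing {k A B : Type*} [Field k] [AddCommGroup A] [AddCommGroup B]
    [Finite B] (b : A →+ B →+ Additive kˣ) (hb : Function.Injective b) :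
    Nat.card A ≤ Nat.card B := by
  have := Fintype.ofFinite B
  let χ : A → (Multiplicative B →* k) := fun a => (Units.coeHom k).comp (b a).toMultiplicativeLeft
  have hχ : Function.Injective χ := by
    intro x y hxy
    apply hb
    ext z
    have := DFunLike.congr_fun hxy (Multiplicative.ofAdd z)
    simpa [χ] using this
  -- Dedekind: distinct characters of `B` are linearly independent in the space of functions `B →
  -- k`, whose dimension is the order of `B`.
  have hli := (linearIndependent_monoidHom (Multiplicative B) k).comp χ hχ
  have : Finite A := hli.finite
  have := Fintype.ofFinite A
  simpa using hli.fintype_card_le_finrank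

/-- Dividing both sides by their kernels embeds `G ⧸ b.ker` into the characters of the finite group
`H ⧸ b.flip.ker`. Applied to `b` and to `b.flip`, this gives equality of the two indices. -/
theorem index_ker_le_index_ker_flip {k G H : Type*} [Field k] [AddCommGroup G] [AddCommGroup H]
    (b : G →+ H →+ Additive kˣ) [b.flip.ker.FiniteIndex] : b.ker.index ≤ b.flip.ker.index := by
  let d : H →+ (G ⧸ b.ker) →+ Additive kˣ := (QuotientAddGroup.kerLift b).flip
  have hd : d.ker = b.flip.ker := by
    ext y
    constructor
    · intro hy
      change b.flip y = 0
      refine AddMonoidHom.ext fun x => ?_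
      exact DFunLike.congr_fun (show d y = 0 from hy) (x : G ⧸ b.ker)
    · intro hy
      change d y = 0
      refine AddMonoidHom.ext fun x => ?_
      obtain ⟨x, rfl⟩ := QuotientAddGroup.mk_surjective x
      exact DFunLike.congr_fun (show b.flip y = 0 from hy) x
  have : d.ker.FiniteIndex := by rwa [hd]
  rw [← hd, AddSubgroup.index, AddSubgroup.index]
  refine card_le_of_injective_pairing (QuotientAddGroup.kerLift d).flip ?_
  rw [injective_iff_map_eq_zero]
  intro x hx
  apply QuotientAddGroup.kerLift_injective b
  rw [map_zero]
  refine AddMonoidHom.ext fun y => ?_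
  exact DFunLike.congr_fun hx (y : H ⧸ d.ker)

/-- The annihilator of a subgroup under a pairing. -/
def AddSubgroup.orthogonal {G V : Type*} [AddCommGroup G] [AddCommGroup V] (b : G →+ G →+ V)
    (M : AddSubgroup G) : AddSubgroup G where
  carrier := {s | ∀ t ∈ M, b s t = 0}
  zero_mem' := by simp
  add_mem' := by
    intro s s' hs hs' t ht
    simp [hs t ht, hs' t ht]
  neg_mem' := by
    intro s hs t ht
    simp [hs t ht]

theorem swap_eq_neg_of_alternating {G V : Type*} [AddCommGroup G] [AddCommGroup V]
    (b : G →+ G →+ V) (halt : ∀ s, b s s = 0) (s t : G) : b s t = -b t s := by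
  have := halt (s + t)
  simp only [map_add, AddMonoidHom.add_apply, halt, zero_add, add_zero] at this
  rw [eq_neg_iff_add_eq_zero, add_comm]
  exact this

/-- An alternating pairing on a finitely generated group has a subgroup that is its own
annihilator. -/
theorem exists_orthogonal_eq_self {G V : Type*} [AddCommGroup G] [AddCommGroup V]
    [Module.Finite ℤ G] (b : G →+ G →+ V) (halt : ∀ s, b s s = 0) :
    ∃ M : AddSubgroup G, M.orthogonal b = M := by
  have hskew := swap_eq_neg_of_alternating b halt
  -- `M` is maximal among the subgroups on which `b` vanishes. Any `s` in its annihilator can be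
  -- adjoined because `b s s = 0`, so maximality forces `s ∈ M`.
  obtain ⟨M, hM, hmax⟩ := set_has_maximal_iff_noetherian.2 (inferInstanceAs (IsNoetherian ℤ G))
    {M : Submodule ℤ G | ∀ s ∈ M, ∀ t ∈ M, b s t = 0} ⟨⊥, by simp⟩
  refine ⟨M.toAddSubgroup, le_antisymm (fun s hs => ?_) fun s hs => hM s hs⟩
  replace hs : ∀ t ∈ M, b s t = 0 := hs
  by_contra hsM
  refine hmax (M ⊔ ℤ ∙ s) ?_ ?_
  · rintro _ hx' _ hy'
    obtain ⟨x, hx, z, hz, rfl⟩ := Submodule.mem_sup.1 hx'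
    obtain ⟨y, hy, w, hw, rfl⟩ := Submodule.mem_sup.1 hy'
    obtain ⟨c, rfl⟩ := Submodule.mem_span_singleton.1 hz
    obtain ⟨d, rfl⟩ := Submodule.mem_span_singleton.1 hw
    simp [show b x y = 0 from hM x hx y hy, hs y hy, hskew x s, hs x hx, halt]
  · refine lt_of_le_of_ne le_sup_left fun h => hsM ?_
    change s ∈ M
    rw [h]
    exact Submodule.mem_sup_right (Submodule.mem_span_singleton_self s)

/-- The index of the radical of an alternating pairing with values in the units of a field is the
square of the index of a subgroup that is its own annihilator. -/
theorem index_sq_eq_index_ker {k G : Type*} [Field k] [AddCommGroup G]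
    (b : G →+ G →+ Additive kˣ) (halt : ∀ s, b s s = 0) [b.ker.FiniteIndex] (M : AddSubgroup G)
    (hM : M.orthogonal b = M) : b.ker ≤ M ∧ M.index ^ 2 = b.ker.index := by
  have hskew := swap_eq_neg_of_alternating b halt
  have hle : b.ker ≤ M := by
    intro s hs
    rw [← hM]
    intro t _
    rw [show b s = 0 from hs]
    rfl
  refine ⟨hle, ?_⟩
  -- The pairing between `M` and `G` has left kernel `b.ker` and right kernel `M`, so duality gives
  -- `[M : b.ker] = [G : M]`.
  let c : M →+ G →+ Additive kˣ := b.comp M.subtype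
  have h1 : c.flip.ker = M := by
    ext s
    refine Iff.trans ?_ (SetLike.ext_iff.1 hM s)
    constructor
    · intro hs t ht
      rw [hskew]
      exact neg_eq_zero.2 (DFunLike.congr_fun (show c.flip s = 0 from hs) ⟨t, ht⟩)
    · intro hs
      change c.flip s = 0
      refine AddMonoidHom.ext fun t => ?_
      change b t s = 0
      rw [hskew, hs t t.2, neg_zero]
  have h2 : c.ker = b.ker.addSubgroupOf M := by
    ext s
    rfl
  have : M.FiniteIndex := AddSubgroup.finiteIndex_of_le hle
  have : c.flip.ker.FiniteIndex := by rwa [h1]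
  have : c.flip.flip.ker.FiniteIndex := by
    change c.ker.FiniteIndex
    rw [h2]
    infer_instance
  have h3 : c.ker.index = M.index := by
    refine Eq.trans ?_ (congrArg AddSubgroup.index h1)
    exact le_antisymm (index_ker_le_index_ker_flip c) (index_ker_le_index_ker_flip c.flip)
  rw [← AddSubgroup.relIndex_mul_index hle, AddSubgroup.relIndex, ← h2, h3, sq]


/-! ### Commutation of monomials, the center of `L` and monomial bases -/

theorem zpow_sum {G ι : Type*} [CommGroup G] (g : G) (I : Finset ι) (a : ι → ℤ) :
    g ^ ∑ i ∈ I, a i = ∏ i ∈ I, g ^ a i := by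
  classical
  induction I using Finset.induction_on with
  | empty => simp
  | insert i I hi ih => rw [Finset.sum_insert hi, Finset.prod_insert hi, zpow_add, ih]

namespace QLaurent

variable {k : Type*} [Field k] {n : ℕ} {q : Matrix (Fin n) (Fin n) kˣ}

/-- The bimultiplicative map `qFactor` as a pairing. -/
def qFactorHom (q : Matrix (Fin n) (Fin n) kˣ) : (Fin n → ℤ) →+ (Fin n → ℤ) →+ Additive kˣ :=
  AddMonoidHom.mk' (fun s => AddMonoidHom.mk' (fun t => Additive.ofMul (qFactor q s t))
    fun t t' => by rw [qFactor_add_right, ofMul_mul])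
    fun s s' => AddMonoidHom.ext fun t => by simp [qFactor_add_left]

/-- The commutation pairing of monomials: `x ^ s x ^ t = commutation q s t • x ^ t x ^ s`. -/
def commutation (q : Matrix (Fin n) (Fin n) kˣ) : (Fin n → ℤ) →+ (Fin n → ℤ) →+ Additive kˣ :=
  qFactorHom q - (qFactorHom q).flip

theorem commutation_apply (s t : Fin n → ℤ) :
    commutation q s t = Additive.ofMul (qFactor q s t / qFactor q t s) := rfl

theorem commutation_self (s : Fin n → ℤ) : commutation q s s = 0 := by
  simp [commutation_apply]

theorem commutation_swap (s t : Fin n → ℤ) : commutation q s t = -commutation q t s := by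
  simp [commutation_apply]

theorem commutation_eq_zero_iff {s t : Fin n → ℤ} :
    commutation q s t = 0 ↔ qFactor q s t = qFactor q t s := by
  rw [commutation_apply, ofMul_eq_zero, div_eq_one]

theorem mul_comm_of_commutation_eq_zero {f g : QLaurent q}
    (h : ∀ a b, f.coeff a ≠ 0 → g.coeff b ≠ 0 → commutation q a b = 0) : f * g = g * f := by
  ext s
  rw [coeff_mul, coeff_mul, ← finsum_comp_equiv (Equiv.subLeft s)]
  refine finsum_congr fun a => ?_
  simp only [mulTerm, Equiv.subLeft_apply, sub_sub_cancel]
  by_cases hf : f.coeff (s - a) = 0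
  · simp [hf]
  by_cases hg : g.coeff a = 0
  · simp [hg]
  rw [commutation_eq_zero_iff.1 (h _ _ hf hg)]
  ring

/-- The series with support in a subgroup of the group of exponents. -/
def supportedSubring (q : Matrix (Fin n) (Fin n) kˣ) (M : AddSubgroup (Fin n → ℤ)) :
    Subring (QLaurent q) where
  carrier := {f | ∀ s, f.coeff s ≠ 0 → s ∈ M}
  zero_mem' := by simp
  one_mem' := by
    intro s hs
    rw [one_def, coeff_monomial] at hs
    by_cases h : s = 0
    · simp [h]
    · simp [h] at hs
  add_mem' := by
    intro f g hf hg s hs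
    by_cases h : f.coeff s = 0
    · exact hg s fun h' => hs (by simp [h, h'])
    · exact hf s h
  neg_mem' := by
    intro f hf s hs
    exact hf s fun h => hs (neg_eq_zero.2 h)
  mul_mem' := by
    intro f g hf hg s hs
    obtain ⟨a, ha⟩ : ∃ a, mulTerm f g s a ≠ 0 := by
      by_contra! h
      exact hs (by rw [coeff_mul]; simp [h])
    have h1 : f.coeff a ≠ 0 := fun h => ha (by simp [mulTerm, h])
    have h2 : g.coeff (s - a) ≠ 0 := fun h => ha (by simp [mulTerm, h])
    simpa using M.add_mem (hf a h1) (hg _ h2)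

theorem mem_supportedSubring {M : AddSubgroup (Fin n → ℤ)} {f : QLaurent q} :
    f ∈ supportedSubring q M ↔ ∀ s, f.coeff s ≠ 0 → s ∈ M := Iff.rfl

/-- Commuting with `x ^ t` is a condition on each coefficient separately: an exponent `s` may occur
only if it pairs trivially with `t`. -/
theorem center_eq_supportedSubring :
    Subring.center (QLaurent q) = supportedSubring q (commutation q).ker := by
  ext f
  rw [Subring.mem_center_iff, mem_supportedSubring]
  constructor
  · intro h s hs
    refine AddMonoidHom.ext fun t => ?_
    have := congrArg (fun g => g.coeff (t + s)) (h (monomial t 1))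
    simp only [coeff_monomial_mul, coeff_mul_monomial, add_sub_cancel_left,
      one_mul, mul_one] at this
    exact commutation_eq_zero_iff.2 (Units.ext (mul_left_cancel₀ hs this)).symm
  · intro h g
    refine (mul_comm_of_commutation_eq_zero fun a b ha _ => ?_).symm
    rw [show commutation q a = 0 from h a ha]
    rfl

/-- The terms of a series with exponents in a given set. -/
def restrict (T : Set (Fin n → ℤ)) (f : QLaurent q) : QLaurent q :=
  mk (T.indicator f.coeff) <| by
    obtain ⟨N, hN⟩ := f.exists_bound
    exact ⟨N, fun s hs => hN s fun h => hs (by simp [h])⟩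

theorem coeff_restrict (T : Set (Fin n → ℤ)) (f : QLaurent q) (s : Fin n → ℤ) :
    (restrict T f).coeff s = T.indicator f.coeff s := rfl

theorem coeff_sum {ι : Type*} (I : Finset ι) (f : ι → QLaurent q) (s : Fin n → ℤ) :
    (∑ i ∈ I, f i).coeff s = ∑ i ∈ I, (f i).coeff s :=
  map_sum (AddMonoidHom.mk' (fun f : QLaurent q => f.coeff s) fun _ _ => rfl) f I

theorem monomial_mul_monomial_neg (s : Fin n → ℤ) :
    (monomial s 1 * monomial (-s) (qFactor q s (-s) : k)⁻¹ : QLaurent q) = 1 := by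
  simp [monomial_mul_monomial, one_def]

/-- If the scalars of a module structure on `L` act as right multiplications by the series with
support in `M`, then the monomials with exponents in a transversal of `M` form a basis. -/
theorem exists_basis_monomial (M : AddSubgroup (Fin n → ℤ)) [Finite ((Fin n → ℤ) ⧸ M)]
    {C : Type*} [CommRing C] [Module C (QLaurent q)] (φ : C → QLaurent q)
    (hφ : Function.Injective φ) (hsmul : ∀ (c : C) (f : QLaurent q), c • f = f * φ c)
    (hrange : Set.range φ = supportedSubring q M) :
    ∃ b : Module.Basis ((Fin n → ℤ) ⧸ M) C (QLaurent q), ∀ c, b c = monomial c.out 1 := by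
  have := Fintype.ofFinite ((Fin n → ℤ) ⧸ M)
  have hφ0 : φ 0 = 0 := by simpa using (hsmul 0 1).symm
  let v : (Fin n → ℤ) ⧸ M → QLaurent q := fun c => monomial c.out 1
  have hli : LinearIndependent C v := by
    rw [Fintype.linearIndependent_iff]
    intro g hg i
    apply hφ
    rw [hφ0]
    ext u
    by_contra hu
    -- Here `u ∈ M`, so the exponent `i.out + u` lies in the class `i`, and the terms of all other
    -- classes contribute nothing.
    have h1 := congrArg (fun f => f.coeff (i.out + u)) hg
    simp only [coeff_sum, hsmul, v, coeff_monomial_mul, coeff_zero, one_mul] at h1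
    have hu' : φ (g i) ∈ supportedSubring q M := by
      rw [← SetLike.mem_coe, ← hrange]
      exact Set.mem_range_self _
    rw [Finset.sum_eq_single i] at h1
    · rw [add_sub_cancel_left] at h1
      exact (mul_ne_zero hu (Units.ne_zero _)) h1
    · intro j _ hj
      rw [mul_eq_zero]
      left
      by_contra hne
      have hj' : φ (g j) ∈ supportedSubring q M := by
        rw [← SetLike.mem_coe, ← hrange]
        exact Set.mem_range_self _
      apply hj
      have h2 := M.sub_mem (hu' u hu) (hj' _ hne)
      rw [← QuotientAddGroup.out_eq' j, ← QuotientAddGroup.out_eq' i, QuotientAddGroup.eq]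
      convert M.neg_mem h2 using 1
      abel
    · simp
  have hspan : ⊤ ≤ Submodule.span C (Set.range v) := by
    intro f _
    have hf : f = ∑ c : (Fin n → ℤ) ⧸ M, restrict {s | (s : (Fin n → ℤ) ⧸ M) = c} f := by
      ext s
      rw [coeff_sum, Finset.sum_eq_single (s : (Fin n → ℤ) ⧸ M)]
      · simp [coeff_restrict]
      · intro c _ hc
        simp [coeff_restrict, hc.symm]
      · simp
    rw [hf]
    refine Submodule.sum_mem _ fun c _ => ?_
    generalize hr : restrict {s | (s : (Fin n → ℤ) ⧸ M) = c} f = r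
    -- Dividing the part of `f` in the class `c` by `x ^ c.out` on the left leaves a series
    -- supported in `M`, which is a scalar.
    let g : QLaurent q := monomial (-c.out) (qFactor q c.out (-c.out) : k)⁻¹ * r
    have hg : g ∈ supportedSubring q M := by
      intro s hs
      rw [coeff_monomial_mul] at hs
      have h1 := right_ne_zero_of_mul (left_ne_zero_of_mul hs)
      rw [← hr, coeff_restrict] at h1
      have h2 := Set.mem_of_indicator_ne_zero h1
      rw [Set.mem_ofPred_eq, ← QuotientAddGroup.out_eq' c, eq_comm, QuotientAddGroup.eq] at h2
      simpa using h2
    rw [← SetLike.mem_coe, ← hrange] at hg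
    obtain ⟨a, ha⟩ := hg
    have : r = a • v c := by
      rw [hsmul, ha, ← mul_assoc, monomial_mul_monomial_neg, one_mul]
    rw [this]
    exact Submodule.smul_mem _ _ (Submodule.subset_span (Set.mem_range_self c))
  exact ⟨Module.Basis.mk hli hspan, fun c => by simp [v]⟩

/-- If the monomials with exponents in a subgroup `M` of index `p` commute with each other, then `L`
satisfies the polynomial identities of `p × p` matrices. -/
theorem isPolynomialIdentity_of_commutation_eq_zero (M : AddSubgroup (Fin n → ℤ)) [M.FiniteIndex]
    (hM : ∀ s ∈ M, ∀ t ∈ M, commutation q s t = 0) {f : FreeAlgebra ℤ ℕ}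
    (hf : IsPolynomialIdentity f (Matrix (Fin M.index) (Fin M.index) ℤ)) :
    IsPolynomialIdentity f (QLaurent q) := by
  -- The scalars act by right multiplication, hence the opposite ring; left multiplications by `L`
  -- are then `K`-linear.
  let K := (supportedSubring q M).op
  let _ : CommRing K :=
    { (inferInstance : Ring K) with
      mul_comm := fun a b => Subtype.ext (MulOpposite.unop_injective
        (mul_comm_of_commutation_eq_zero fun s t hs ht => hM s (b.2 s hs) t (a.2 t ht))) }
  have := Fintype.ofFinite ((Fin n → ℤ) ⧸ M)
  obtain ⟨b, -⟩ := exists_basis_monomial (q := q) (C := K) M (fun c => c.1.unop)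
    (MulOpposite.unop_injective.comp Subtype.val_injective) (fun _ _ => rfl)
    (by
      ext g
      exact ⟨by rintro ⟨c, rfl⟩; exact c.2, fun hg => ⟨⟨MulOpposite.op g, hg⟩, rfl⟩⟩)
  refine hf.of_faithful_action b rfl
    { toFun := fun g => { toFun := fun x => g * x
                          map_add' := mul_add g
                          map_smul' := fun c x => (mul_assoc g x c.1.unop).symm }
      map_one' := LinearMap.ext one_mul
      map_mul' := fun g h => LinearMap.ext (mul_assoc g h)
      map_zero' := LinearMap.ext zero_mul
      map_add' := fun g h => LinearMap.ext (add_mul g h) } fun g h hgh => ?_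
  simpa using LinearMap.congr_fun hgh 1

/-! ### Separation of monomials by two-sided multiplications -/

/-- The left factors of the two-sided multiplications that separate monomials. -/
def separatorLeft (q : Matrix (Fin n) (Fin n) kˣ) {l : ℕ} (t : Fin n → Fin l) : QLaurent q :=
  monomial (fun i => ((t i : ℕ) : ℤ)) 1

/-- The right factors of the two-sided multiplications that separate monomials. -/
def separatorRight (q : Matrix (Fin n) (Fin n) kˣ) {l : ℕ} (w s : Fin n → ℤ) (t : Fin n → Fin l) :
    QLaurent q :=
  monomial (w - fun i => ((t i : ℕ) : ℤ))
    (((commutation q (fun i => ((t i : ℕ) : ℤ)) s).toMul : k)⁻¹ *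
      (qFactor q (fun i => ((t i : ℕ) : ℤ)) (w - fun i => ((t i : ℕ) : ℤ)) : k)⁻¹)

/-- Conjugation by `x ^ t` scales `x ^ s'` by `b(t, s')`, and the right factor divides by `b(t, s)`.
The shift `w` is `0` for plain conjugation, and `(l, …, l)` to keep the exponents `w - t`
nonnegative. -/
theorem separatorLeft_mul_monomial_mul_separatorRight {l : ℕ} (w s s' : Fin n → ℤ)
    (t : Fin n → Fin l) :
    separatorLeft q t * monomial s' 1 * separatorRight q w s t =
      ((commutation q (fun i => ((t i : ℕ) : ℤ)) (s' - s)).toMul : k) •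
        (monomial s' 1 * monomial w 1) := by
  generalize hu : (fun i => ((t i : ℕ) : ℤ)) = u
  have h1 : (monomial u 1 * monomial s' 1 : QLaurent q) =
      monomial s' ((commutation q u s').toMul : k) * monomial u 1 := by
    rw [monomial_mul_monomial, monomial_mul_monomial, add_comm]
    congr 1
    simp [commutation_apply]
  have h2 : (monomial s' ((commutation q u (s' - s)).toMul : k) * monomial w 1 : QLaurent q) =
      ((commutation q u (s' - s)).toMul : k) • (monomial s' 1 * monomial w 1) := by
    ext x
    rw [coeff_smul, coeff_monomial_mul, coeff_monomial_mul]
    ring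
  rw [separatorLeft, separatorRight, hu, h1, mul_assoc, ← h2, monomial_mul_monomial,
    monomial_mul_monomial, monomial_mul_monomial, add_sub_cancel]
  congr 1
  rw [map_sub, toMul_sub, Units.val_div_eq_div_val]
  field_simp

section

variable {l : ℕ} {ε : kˣ} {η : Matrix (Fin n) (Fin n) ℤ}

theorem commutation_eq_zpow (hq_diag : ∀ i, q i i = 1) (hq : ∀ i j, q i j = (q j i)⁻¹)
    (hη : ∀ i j, q i j = ε ^ η i j) (s t : Fin n → ℤ) :
    (commutation q s t).toMul = ε ^ (s ⬝ᵥ η.mulVec t) := by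
  -- The factors with `j < i` come from `qFactor q s t`, those with `i < j` from the inverse of
  -- `qFactor q t s`; the diagonal is trivial.
  have h1 : (commutation q s t).toMul = ∏ i, ∏ j, q i j ^ (s i * t j) := by
    rw [commutation_apply, toMul_ofMul, div_eq_mul_inv]
    have h2 : (qFactor q t s)⁻¹ = ∏ i, ∏ j, if i < j then q i j ^ (s i * t j) else 1 := by
      rw [qFactor, Finset.prod_comm]
      simp only [← Finset.prod_inv_distrib]
      refine Finset.prod_congr rfl fun i _ => Finset.prod_congr rfl fun j _ => ?_
      rw [hq i j]
      split_ifs <;> simp [mul_comm]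
    rw [h2, qFactor]
    simp only [← Finset.prod_mul_distrib]
    refine Finset.prod_congr rfl fun i _ => Finset.prod_congr rfl fun j _ => ?_
    rcases lt_trichotomy i j with h | h | h
    · simp [h, not_lt_of_gt h]
    · simp [h, hq_diag]
    · simp [h, not_lt_of_gt h]
  rw [h1]
  simp only [hη, ← zpow_mul]
  simp only [dotProduct, Matrix.mulVec, Finset.mul_sum]
  simp only [zpow_sum]
  refine Finset.prod_congr rfl fun i _ => Finset.prod_congr rfl fun j _ => ?_
  congr 1
  ring

/-- Since `ε` has order `l`, pairing `s` with the unit vectors tests the coordinates of `η.mulVec s`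
modulo `l`. -/
theorem ker_exponentHom (hq_diag : ∀ i, q i i = 1) (hq : ∀ i j, q i j = (q j i)⁻¹)
    (hl : orderOf ε = l) (hη : ∀ i j, q i j = ε ^ η i j) :
    (exponentHom η l).ker = (commutation q).ker := by
  ext s
  have h1 : s ∈ (exponentHom η l).ker ↔ ∀ i, (l : ℤ) ∣ η.mulVec s i := by
    rw [AddMonoidHom.mem_ker, funext_iff]
    exact forall_congr' fun i => ZMod.intCast_zmod_eq_zero_iff_dvd _ _
  rw [h1, AddMonoidHom.mem_ker]
  constructor
  · intro h
    refine AddMonoidHom.ext fun t => ?_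
    rw [commutation_swap, AddMonoidHom.zero_apply, neg_eq_zero]
    change (commutation q t s).toMul = 1
    rw [commutation_eq_zpow hq_diag hq hη, ← orderOf_dvd_iff_zpow_eq_one, hl]
    exact Finset.dvd_sum fun i _ => (h i).mul_left _
  · intro h i
    have h2 : (commutation q (Pi.single i 1) s).toMul = 1 := by
      rw [commutation_swap, h]
      rfl
    rwa [commutation_eq_zpow hq_diag hq hη, ← orderOf_dvd_iff_zpow_eq_one, hl,
      single_one_dotProduct] at h2

/-- Orthogonality of characters: the sum is a product of geometric sums over powers of `ε ^ η.mulVec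
s i`, and one of these `l`-th roots of unity differs from `1`. -/
theorem sum_commutation_eq_zero (hq_diag : ∀ i, q i i = 1) (hq : ∀ i j, q i j = (q j i)⁻¹)
    (hl : orderOf ε = l) (hη : ∀ i j, q i j = ε ^ η i j) {s : Fin n → ℤ}
    (hs : s ∉ (commutation q).ker) :
    ∑ t : Fin n → Fin l, ((commutation q (fun i => ((t i : ℕ) : ℤ)) s).toMul : k) = 0 := by
  rw [← ker_exponentHom hq_diag hq hl hη] at hs
  obtain ⟨i, hi⟩ : ∃ i, ε ^ η.mulVec s i ≠ 1 := by
    by_contra! h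
    refine hs (funext fun i => (ZMod.intCast_zmod_eq_zero_iff_dvd _ _).2 ?_)
    rw [← hl, orderOf_dvd_iff_zpow_eq_one]
    exact h i
  let z : Fin n → k := fun i => ((ε ^ η.mulVec s i : kˣ) : k)
  have h1 : ∀ t : Fin n → Fin l,
      ((commutation q (fun i => ((t i : ℕ) : ℤ)) s).toMul : k) = ∏ i, z i ^ (t i : ℕ) := by
    intro t
    rw [commutation_eq_zpow hq_diag hq hη, dotProduct, zpow_sum, Units.coe_prod]
    refine Finset.prod_congr rfl fun i _ => ?_
    rw [mul_comm, zpow_mul, zpow_natCast, Units.val_pow_eq_pow_val]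
  simp only [h1]
  rw [← Fintype.piFinset_univ, ← Finset.prod_univ_sum (fun _ => Finset.univ)
    fun i (j : Fin l) => z i ^ (j : ℕ)]
  refine Finset.prod_eq_zero (Finset.mem_univ i) ?_
  have hz : z i - 1 ≠ 0 := sub_ne_zero.2 fun h => hi (Units.ext h)
  refine (mul_eq_zero.1 ?_).resolve_right hz
  rw [Fin.sum_univ_eq_sum_range (fun j => z i ^ j), geom_sum_mul, ← Units.val_pow_eq_pow_val,
    ← zpow_natCast, ← zpow_mul, mul_comm, zpow_mul, zpow_natCast, ← hl, pow_orderOf_eq_one]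
  simp

/-- The two-sided multiplications by the separators annihilate the monomials with exponents outside
of one class of the radical. -/
theorem sum_separator_of_notMem (hq_diag : ∀ i, q i i = 1) (hq : ∀ i j, q i j = (q j i)⁻¹)
    (hl : orderOf ε = l) (hη : ∀ i j, q i j = ε ^ η i j) (w : Fin n → ℤ) {s s' : Fin n → ℤ}
    (h : s' - s ∉ (commutation q).ker) :
    ∑ t : Fin n → Fin l, separatorLeft q t * monomial s' 1 * separatorRight q w s t = 0 := by
  simp only [separatorLeft_mul_monomial_mul_separatorRight, ← Finset.sum_smul]
  rw [sum_commutation_eq_zero hq_diag hq hl hη h, zero_smul]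

theorem sum_separator_self (w s : Fin n → ℤ) :
    ∑ t : Fin n → Fin l, separatorLeft q t * monomial s 1 * separatorRight q w s t =
      ((l : k) ^ n) • (monomial s 1 * monomial w 1) := by
  simp only [separatorLeft_mul_monomial_mul_separatorRight, ← Finset.sum_smul]
  simp

/-- A field with a primitive `l`-th root of unity has characteristic prime to `l`. This permits
division by `l ^ n` in the averages. -/
theorem natCast_orderOf_ne_zero (hl : orderOf ε = l) (hl0 : 0 < l) : (l : k) ≠ 0 := by
  have : NeZero l := ⟨hl0.ne'⟩
  have h : IsPrimitiveRoot (ε : k) l :=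
    IsPrimitiveRoot.coe_units_iff.2 (hl ▸ IsPrimitiveRoot.orderOf ε)
  exact h.neZero'.ne

end

end QLaurent


/-! ### The Azumaya property and the lower bound for the PI degree -/

namespace QLaurent

variable {k : Type*} [Field k] {n : ℕ} {q : Matrix (Fin n) (Fin n) kˣ}
  {l : ℕ} {ε : kˣ} {η : Matrix (Fin n) (Fin n) ℤ}

theorem finiteIndex_ker_commutation (hq_diag : ∀ i, q i i = 1) (hq : ∀ i j, q i j = (q j i)⁻¹)
    (hl : orderOf ε = l) (hl0 : 0 < l) (hη : ∀ i j, q i j = ε ^ η i j) :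
    (commutation q).ker.FiniteIndex := by
  have : NeZero l := ⟨hl0.ne'⟩
  rw [← ker_exponentHom hq_diag hq hl hη]
  infer_instance

instance : Nontrivial (QLaurent q) :=
  ⟨1, 0, fun h => by simpa [one_def, coeff_monomial] using congrArg (fun f => f.coeff 0) h⟩

theorem exists_basis_center [(commutation q).ker.FiniteIndex] :
    ∃ b : Module.Basis ((Fin n → ℤ) ⧸ (commutation q).ker) (Subring.center (QLaurent q))
      (QLaurent q), ∀ c, b c = monomial c.out 1 := by
  refine exists_basis_monomial _ (fun c => c.1) Subtype.val_injective
    (fun c f => (Subring.mem_center_iff.1 c.2 f).symm) ?_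
  rw [← center_eq_supportedSubring]
  exact Subtype.range_coe

theorem out_sub_out_mem_iff {G : Type*} [AddCommGroup G] {M : AddSubgroup G} (c d : G ⧸ M) :
    c.out - d.out ∈ M ↔ c = d := by
  rw [← QuotientAddGroup.eq_iff_sub_mem, QuotientAddGroup.out_eq', QuotientAddGroup.out_eq']

-- For each basis monomial, the average attached to its class kills all the others and multiplies it
-- by `l ^ n`. Following it by left multiplication with a suitable element `u c` prescribes the
-- image of that monomial, and the sum over classes is `φ`.
open scoped TensorProduct in
theorem surjective_mulLeftRight (hq_diag : ∀ i, q i i = 1) (hq : ∀ i j, q i j = (q j i)⁻¹)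
    (hl : orderOf ε = l) (hl0 : 0 < l) (hη : ∀ i j, q i j = ε ^ η i j) :
    Function.Surjective (AlgHom.mulLeftRight (Subring.center (QLaurent q)) (QLaurent q)) := by
  classical
  have := finiteIndex_ker_commutation hq_diag hq hl hl0 hη
  have := Fintype.ofFinite ((Fin n → ℤ) ⧸ (commutation q).ker)
  obtain ⟨b, hb⟩ := exists_basis_center (q := q)
  intro φ
  let u : (Fin n → ℤ) ⧸ (commutation q).ker → QLaurent q := fun c =>
    ((l : k) ^ n)⁻¹ • (φ (b c) * monomial (-c.out) (qFactor q c.out (-c.out) : k)⁻¹)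
  refine ⟨∑ c, ∑ t : Fin n → Fin l, (u c * separatorLeft q t) ⊗ₜ
    MulOpposite.op (separatorRight q 0 c.out t), b.ext fun d => ?_⟩
  have h1 : ∀ c, ∑ t : Fin n → Fin l, u c * separatorLeft q t * b d * separatorRight q 0 c.out t =
      if c = d then φ (b d) else 0 := by
    intro c
    simp only [mul_assoc, ← Finset.mul_sum]
    simp only [← mul_assoc (separatorLeft q _)]
    rw [hb d]
    by_cases hcd : d = c
    · subst hcd
      have h2 : (l : k) ^ n ≠ 0 := pow_ne_zero _ (natCast_orderOf_ne_zero hl hl0)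
      have h3 : (monomial (-d.out) (qFactor q d.out (-d.out) : k)⁻¹ * monomial d.out 1 :
          QLaurent q) = 1 := by
        apply (isUnit_monomial (q := q) d.out (one_ne_zero (α := k))).mul_left_cancel
        rw [← mul_assoc, monomial_mul_monomial_neg, one_mul, mul_one]
      rw [sum_separator_self, if_pos rfl, ← one_def, mul_one, mul_smul_comm, smul_mul_assoc, smul_smul,
        mul_inv_cancel₀ h2, one_smul, mul_assoc, h3, mul_one, hb]
    · rw [sum_separator_of_notMem hq_diag hq hl hη _ fun h => hcd ((out_sub_out_mem_iff d c).1 h),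
        if_neg (Ne.symm hcd), mul_zero]
  simp only [map_sum, LinearMap.sum_apply, AlgHom.mulLeftRight_apply, MulOpposite.unop_op, h1]
  simp

theorem isAzumaya_center (hq_diag : ∀ i, q i i = 1) (hq : ∀ i j, q i j = (q j i)⁻¹)
    (hl : orderOf ε = l) (hl0 : 0 < l) (hη : ∀ i j, q i j = ε ^ η i j) :
    IsAzumaya (Subring.center (QLaurent q)) (QLaurent q) := by
  have := finiteIndex_ker_commutation hq_diag hq hl hl0 hη
  obtain ⟨b, -⟩ := exists_basis_center (q := q)
  have hfree := Module.Free.of_basis b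
  have hfin := Module.Finite.of_basis b
  let e : QLaurent q ≃ₗ[Subring.center (QLaurent q)] (QLaurent q)ᵐᵒᵖ := MulOpposite.opLinearEquiv _
  have := Module.Free.of_equiv e
  have := Module.Finite.equiv e
  have hs := surjective_mulLeftRight hq_diag hq hl hl0 hη
  refine { bij := ⟨?_, hs⟩, eq_of_smul_eq_smul := fun {c d} h => Subtype.ext (by simpa [Subring.smul_def] using h 1) }
  -- Both modules are free, of rank the square of that of `L`. Identifying them turns the surjection
  -- into a surjective endomorphism of a finite module, which is injective.
  let E := LinearEquiv.ofFinrankEq (R := Subring.center (QLaurent q))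
    (Module.End (Subring.center (QLaurent q)) (QLaurent q))
    (TensorProduct (Subring.center (QLaurent q)) (QLaurent q) (QLaurent q)ᵐᵒᵖ) (by
        rw [Module.finrank_linearMap, Module.finrank_tensorProduct, e.finrank_eq])
  exact Function.Injective.of_comp (OrzechProperty.injective_of_surjective_endomorphism
    (E.toLinearMap.comp
      (AlgHom.mulLeftRight (Subring.center (QLaurent q)) (QLaurent q)).toLinearMap)
    (E.surjective.comp hs))

theorem monomial_mem_qPowerSeries {s : Fin n → ℤ} (hs : ∀ i, 0 ≤ s i) (c : k) :
    (monomial s c : QLaurent q) ∈ qPowerSeries q := by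
  intro t ht
  rw [coeff_monomial] at ht
  have : t = s := by
    by_contra h
    simp [h] at ht
  rwa [this]

theorem separatorLeft_mem_qPowerSeries (t : Fin n → Fin l) :
    separatorLeft q t ∈ qPowerSeries q :=
  monomial_mem_qPowerSeries (fun _ => by positivity) _

theorem separatorRight_mem_qPowerSeries (s : Fin n → ℤ) (t : Fin n → Fin l) :
    separatorRight q (fun _ => (l : ℤ)) s t ∈ qPowerSeries q :=
  monomial_mem_qPowerSeries (fun i => by simp [(t i).2.le]) _

/-- The radical contains `l ℤ ^ n`, so representatives may be reduced modulo `l`; their monomials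
then lie in the power series ring. -/
theorem exists_nonneg_transversal (hq_diag : ∀ i, q i i = 1) (hq : ∀ i j, q i j = (q j i)⁻¹)
    (hl : orderOf ε = l) (hl0 : 0 < l) (hη : ∀ i j, q i j = ε ^ η i j) {m : ℕ}
    (hm : m ≤ (commutation q).ker.index) :
    ∃ s : Fin m → Fin n → ℤ, (∀ j i, 0 ≤ s j i) ∧
      ∀ i j, s j - s i ∈ (commutation q).ker → i = j := by
  have := finiteIndex_ker_commutation hq_diag hq hl hl0 hη
  have := Fintype.ofFinite ((Fin n → ℤ) ⧸ (commutation q).ker)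
  obtain ⟨c⟩ : Nonempty (Fin m ↪ (Fin n → ℤ) ⧸ (commutation q).ker) := by
    refine Function.Embedding.nonempty_of_card_le ?_
    rw [Fintype.card_fin, ← Nat.card_eq_fintype_card]
    exact hm
  refine ⟨fun j i => (c j).out i % l, fun j i => Int.emod_nonneg _ (by positivity),
    fun i j h => ?_⟩
  have h1 : ∀ j, ((c j).out - fun i => (c j).out i % l) ∈ (commutation q).ker := by
    intro j
    refine (SetLike.ext_iff.1 (ker_exponentHom hq_diag hq hl hη) _).1 ?_
    have h2 : ((c j).out - fun i => (c j).out i % l) = (l : ℤ) • fun i => (c j).out i / l := by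
      funext i
      have := Int.emod_add_mul_ediv ((c j).out i) l
      simp only [Pi.sub_apply, Pi.smul_apply, smul_eq_mul]
      linarith
    rw [h2, AddMonoidHom.mem_ker, map_zsmul]
    funext i
    simp
  apply c.injective
  rw [← out_sub_out_mem_iff]
  have := AddSubgroup.sub_mem _ (AddSubgroup.sub_mem _ (h1 i) h) (h1 j)
  convert this using 1
  abel

theorem isUnit_sum_separator (hl : orderOf ε = l) (hl0 : 0 < l) (w s : Fin n → ℤ) :
    IsUnit (∑ t : Fin n → Fin l, separatorLeft q t * monomial s 1 * separatorRight q w s t) := by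
  have h2 : (l : k) ^ n ≠ 0 := pow_ne_zero _ (natCast_orderOf_ne_zero hl hl0)
  rw [sum_separator_self, Algebra.smul_def]
  exact ((isUnit_iff_ne_zero.2 h2).map (algebraMap k (QLaurent q))).mul
    ((isUnit_monomial s one_ne_zero).mul (isUnit_monomial w one_ne_zero))

/-- The polynomial identities of `p × p` matrices fail in the power series ring if `p ^ 2` is less
than the index of the radical. -/
theorem index_ker_commutation_le (hq_diag : ∀ i, q i i = 1) (hq : ∀ i j, q i j = (q j i)⁻¹)
    (hl : orderOf ε = l) (hl0 : 0 < l) (hη : ∀ i j, q i j = ε ^ η i j) {p : ℕ}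
    (hp : ∀ f : FreeAlgebra ℤ ℕ, IsPolynomialIdentity f (Matrix (Fin p) (Fin p) ℤ) →
      IsPolynomialIdentity f (qPowerSeries q)) :
    (commutation q).ker.index ≤ p ^ 2 := by
  by_contra! hlt
  obtain ⟨m, hm, hm'⟩ : ∃ m, p ^ 2 < m ∧ m ≤ (commutation q).ker.index := ⟨_, hlt, le_rfl⟩
  obtain ⟨s, hs0, hs⟩ := exists_nonneg_transversal hq_diag hq hl hl0 hη hm'
  have hcap := hp _ (isPolynomialIdentity_capelliPolynomial hm)
  obtain ⟨r, hr⟩ := exists_capelli_ne_zero (fun i => (monomial (s i) 1 : QLaurent q))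
    (fun _ t => separatorLeft q t) (fun i t => separatorRight q (fun _ => (l : ℤ)) (s i) t)
    (fun i j hij => sum_separator_of_notMem hq_diag hq hl hη _ fun h => hij (hs i j h))
    (fun i => isUnit_sum_separator hl hl0 _ _)
  apply hr
  -- The nonzero value was found in `L`, where monomials are units, but all its arguments have
  -- nonnegative exponents, so it is a value on `R`.
  let y : Fin m → qPowerSeries q := fun i => ⟨monomial (s i) 1, monomial_mem_qPowerSeries (hs0 i) 1⟩
  let a : Fin m → qPowerSeries q := fun i => ⟨_, separatorLeft_mem_qPowerSeries (r i)⟩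
  let b : Fin m → qPowerSeries q := fun i => ⟨_, separatorRight_mem_qPowerSeries (s i) (r i)⟩
  have h0 := congrArg (qPowerSeries q).val.toRingHom
    (capelli_eq_zero_of_isPolynomialIdentity hcap y a b)
  rw [map_capelli, map_zero] at h0
  exact h0

end QLaurent

end

theorem proposition2p8 {k : Type*} [Field k] [IsAlgClosed k] (n : ℕ) (hn : 0 < n)
    (q : Matrix (Fin n) (Fin n) kˣ) (hq_diag : ∀ i, q i i = 1) (hq : ∀ i j, q i j = (q j i)⁻¹)
    (hroot : ∀ i j, IsOfFinOrder (q i j))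
    (l : ℕ) (hl : l = Nat.card (Subgroup.closure {u : kˣ | ∃ i j, q i j = u}))
    (ε : kˣ) (hε : Subgroup.zpowers ε = Subgroup.closure {u : kˣ | ∃ i j, q i j = u})
    (η : Matrix (Fin n) (Fin n) ℤ) (hη : ∀ i j, q i j = ε ^ η i j) :
    ∃ d : ℕ, d ^ 2 = Nat.card (exponentHom η l).range ∧
      HasPIDegree (qPowerSeries q) d ∧
      IsAzumaya (Subring.center (QLaurent q)) (QLaurent q) ∧
      HasPIDegree (QLaurent q) d := by
  have hord : orderOf ε = l := by rw [hl, ← hε, Nat.card_zpowers]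
  have hl0 : 0 < l := by
    -- `ε` lies in the group generated by the roots of unity `q i j`, which is torsion; so `l` is a
    -- true order and not the default value `0`.
    have hle : Subgroup.zpowers ε ≤ CommGroup.torsion kˣ := by
      rw [hε, Subgroup.closure_le]
      rintro _ ⟨i, j, rfl⟩
      exact hroot i j
    rw [← hord]
    exact IsOfFinOrder.orderOf_pos (hle (Subgroup.mem_zpowers ε))
  have := QLaurent.finiteIndex_ker_commutation hq_diag hq hord hl0 hη
  obtain ⟨M, hM⟩ := exists_orthogonal_eq_self (QLaurent.commutation q) QLaurent.commutation_self
  obtain ⟨hle, hsq⟩ := index_sq_eq_index_ker _ QLaurent.commutation_self M hM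
  have : M.FiniteIndex := AddSubgroup.finiteIndex_of_le hle
  have hMM : ∀ s ∈ M, ∀ t ∈ M, QLaurent.commutation q s t = 0 := fun s hs =>
    (SetLike.ext_iff.1 hM s).2 hs
  have hpos : 0 < M.index := Nat.pos_of_ne_zero AddSubgroup.FiniteIndex.index_ne_zero
  have hval : Function.Injective (qPowerSeries q).val.toRingHom := Subtype.val_injective
  -- As `R ⊆ L`, the lower bound for `R` also serves `L`, and the upper bound for `L` also serves
  -- `R`.
  have hlower : ∀ p : ℕ, (∀ f : FreeAlgebra ℤ ℕ,
      IsPolynomialIdentity f (Matrix (Fin p) (Fin p) ℤ) →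
        IsPolynomialIdentity f (qPowerSeries q)) → M.index ≤ p := fun p hp =>
    (Nat.pow_le_pow_iff_left two_ne_zero).1
      (hsq.trans_le (QLaurent.index_ker_commutation_le hq_diag hq hord hl0 hη hp))
  refine ⟨M.index, ?_, ⟨⟨hpos, fun f hf => ?_⟩, fun p hp => hlower p hp.2⟩,
    QLaurent.isAzumaya_center hq_diag hq hord hl0 hη,
    ⟨⟨hpos, fun f hf => QLaurent.isPolynomialIdentity_of_commutation_eq_zero M hMM hf⟩,
      fun p hp => hlower p fun f hf => (hp.2 f hf).of_injective (qPowerSeries q).val.toRingHom hval⟩⟩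
  · rw [hsq, ← AddSubgroup.index_ker, QLaurent.ker_exponentHom hq_diag hq hord hη]
  · exact (QLaurent.isPolynomialIdentity_of_commutation_eq_zero M hMM hf).of_injective
      (qPowerSeries q).val.toRingHom hval
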